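/- Consider a transmitter with $N_t\ge1$ antennas and a receiver with $N_r\ge 1$ antennas. The symbol vector is $\mathbf s\sim\mathcal{CN}(\mathbf 0,\mathbf I_{N_s})$, the beamformed signal is $\mathbf u=\mathbf F_{\rm RF}\mathbf F_{\rm BB}\mathbf s$, where $\mathbf F_{\rm RF}\in\mathbb C^{N_t\times N_{\rm RF}}$ has entries of modulus $\sqrt{1/N_t}$ and $\mathbf F_{\rm BB}\in\mathbb C^{N_{\rm RF}\times N_s}$, $1\le N_s\le N_{\rm RF}$, and every antenna applies the power amplifier $x_n=f(u_n)=\sum_{m=0}^{M}\beta_{2m+1}|u_n|^{2m}u_n$ with coefficients $\beta_{2m+1}\in\mathbb C$. The received signal is $\mathbf y=\mathbf H\mathbf x+\mathbf n$ with $\mathbf n\sim\mathcal{CN}(\mathbf 0,\sigma_n^2\mathbf I_{N_r})$, $\sigma_n^2>0$, and $$\mathbf H=\sqrt{\tfrac{N_tN_r}{L}}\sum_{\ell=1}^{L}\psi_\ell\,\mathbf a_r(\theta_\ell)\mathbf a_t(\phi_\ell)^{\mathsf H},\qquad \psi_\ell\in\mathbb C,\ L\ge1,$$ where $[\mathbf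 a_t(\phi)]_n=N_t^{-1/2}e^{-j2\pi nD_t\sin\phi}$ $(0\le n<N_t)$ and $[\mathbf a_r(\theta)]_n=N_r^{-1/2}e^{-j2\pi nD_r\sin\theta}$ $(0\le n<N_r)$ are the unit-norm array responses, with real spacings $D_t,D_r$ and angles $\phi_\ell,\theta_\ell$. Write $\mathbf C_{\mathbf u}=\mathbb E\{\mathbf u\mathbf u^{\mathsf H}\}$, $\bar{\mathbf G}=\mathrm{diag}\big(\mathbb E\{x_nu_n^*\}/\mathbb E\{|u_n|^2\}\big)$, $\mathbf d=\mathbf x-\bar{\mathbf G}\mathbf u$ and $\mathbf C_{\mathbf d}=\mathbb E\{\mathbf d\mathbf d^{\mathsf H}\}$. The (worst case) spectral efficiency is $$SE=\log_2\det\!\Big(\mathbf I_{N_r}+\big(\mathbf H\mathbf C_{\mathbf d}\mathbf H^{\mathsf H}+\sigma_n^2\mathbf I_{N_r}\big)^{-1}\mathbf H\bar{\mathbf G}\mathbf C_{\mathbf u}\bar{\mathbf G}^{\mathsf H}\mathbf H^{\mathsf H}\Big).$$ For $p>0$ let $\bar g(p)=\sum_{m=0}^{M}\beta_{2m+1}(m+1)!\,p^m$,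 $\gamma_m(p)=\frac1{\sqrt{m+1}}\sum_{q=m}^{M}\beta_{2q+1}\binom qm(q+1)!\,p^{q-m}$, $\bar g_s(p)=|\bar g(p)|^2$ and $\bar g_d(p)=\sum_{m=1}^{M}|\gamma_m(p)|^2p^{2m}$. Let $N_{\rm RF}=1$ (so $N_s=1$), let $P>0$, and let $SE_{\max}$ be the supremum of $SE$ over all admissible $\mathbf F_{\rm RF},\mathbf F_{\rm BB}$ with total input power $\mathbb E\{\|\mathbf u\|^2\}=P$. Let $\ell_{\max}$ be a path with $|\psi_{\ell_{\max}}|=\max_\ell|\psi_\ell|$, let $\phi_{\max}=\phi_{\ell_{\max}}$ and $\theta_{\max}=\theta_{\ell_{\max}}$ be its AoD and AoA, let $\delta=\big|\mathbf a_r(\theta_{\max})^{\mathsf H}\mathbf H\,\mathbf a_t(\phi_{\max})\big|^2$ be the effective channel gain, let $\widetilde{\mathbf H}=\mathbf H\mathbf a_t(\phi_{\max})$, and put $$\overline{SE}=\log_2\det\!\Big(\mathbf I_{N_r}+\big(\bar g_d(\tfrac P{N_t})\,\widetilde{\mathbf H}\widetilde{\mathbf H}^{\mathsf H}+\tfrac{\sigma_n^2}{P}\mathbf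 I_{N_r}\big)^{-1}\bar g_s(\tfrac P{N_t})\,\widetilde{\mathbf H}\widetilde{\mathbf H}^{\mathsf H}\Big).$$ Then $SE_{\max}$ is attained, and $$SE_{\max}\ \ge\ \overline{SE}\ \ge\ \log_2\!\left(1+\frac{\bar g_s(P/N_t)}{\bar g_d(P/N_t)+\frac{\sigma_n^2}{\delta P}}\right),$$ where the right-hand side is read as $0$ if $\delta=0$. The bound is tight when $L=N_{\rm RF}=1$: both inequalities are then equalities. -/

import Mathlib

open MeasureTheory ProbabilityTheory Matrix

noncomputable section

namespace MmWave

/-! ### Array responses and channel -/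

/-- Unit-norm response of a uniform linear array with `N` elements and normalized spacing `D`
in direction `ω`: the `n`-th entry is `N^{-1/2} exp (-j 2 π n D sin ω)`, `n = 0, …, N - 1`. -/
def arrayResponse (N : ℕ) (D ω : ℝ) : Fin N → ℂ := fun n =>
  (1 / Real.sqrt N : ℝ) *
    Complex.exp (-(Complex.I * ((2 * Real.pi * (n : ℕ) * D * Real.sin ω : ℝ) : ℂ)))

/-- The `L`-path channel `H = √(N_t N_r / L) ∑_ℓ ψ_ℓ a_r(θ_ℓ) a_t(φ_ℓ)ᴴ`. -/
def channel (Nt Nr L : ℕ) (Dt Dr : ℝ) (ψ : Fin L → ℂ) (θ φ : Fin L → ℝ) :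
    Matrix (Fin Nr) (Fin Nt) ℂ :=
  ((Real.sqrt ((Nt : ℝ) * Nr / L) : ℝ) : ℂ) •
    ∑ l, ψ l • vecMulVec (arrayResponse Nr Dr (θ l)) (star (arrayResponse Nt Dt (φ l)))

/-! ### Transmitted signal -/

/-- The law `CN(0, 1)`: independent real and imaginary parts, each of variance `1/2`. -/
def stdComplexGaussian : Measure ℂ :=
  ((gaussianReal 0 (1 / 2)).prod (gaussianReal 0 (1 / 2))).map (fun p : ℝ × ℝ => ⟨p.1, p.2⟩)

/-- The law `CN(0, I)` of the vector `s` of `Ns` transmitted symbols. -/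
def symbolLaw (Ns : ℕ) : Measure (Fin Ns → ℂ) := Measure.pi fun _ => stdComplexGaussian

/-- Input-output relation of a power amplifier, a memoryless polynomial of order `2 M + 1`:
`f(z) = ∑_{m=0}^{M} β_{2m+1} |z|^{2m} z`. -/
def amplifier (M : ℕ) (β : ℕ → ℂ) (z : ℂ) : ℂ :=
  ∑ m ∈ Finset.range (M + 1), β (2 * m + 1) * (‖z‖ : ℂ) ^ (2 * m) * z

section Transmitter

variable {Nt NRF Ns : ℕ}

/-- The beamformed signal `u = F_RF F_BB s`. -/
def beamformed (FRF : Matrix (Fin Nt) (Fin NRF) ℂ) (FBB : Matrix (Fin NRF) (Fin Ns) ℂ)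
    (s : Fin Ns → ℂ) : Fin Nt → ℂ := (FRF * FBB) *ᵥ s

/-- The covariance matrix `C_u = E{u uᴴ}`. -/
def inputCov (FRF : Matrix (Fin Nt) (Fin NRF) ℂ) (FBB : Matrix (Fin NRF) (Fin Ns) ℂ) :
    Matrix (Fin Nt) (Fin Nt) ℂ :=
  Matrix.of fun k j =>
    ∫ s, beamformed FRF FBB s k * star (beamformed FRF FBB s j) ∂(symbolLaw Ns)

/-- The total input power `E{‖u‖²} = ∑_n E{|u_n|²}` of the amplification stage. -/
def inputPower (FRF : Matrix (Fin Nt) (Fin NRF) ℂ) (FBB : Matrix (Fin NRF) (Fin Ns) ℂ) : ℝ :=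
  ∫ s, ∑ n, ‖beamformed FRF FBB s n‖ ^ 2 ∂(symbolLaw Ns)

/-- The average linear gain of the amplifier of antenna `n`, `E{x_n u_n^*} / E{|u_n|²}` with
`x_n = f(u_n)`: the coefficient that makes `x_n - g u_n` uncorrelated with `u_n`. -/
def linearGain (M : ℕ) (β : ℕ → ℂ) (FRF : Matrix (Fin Nt) (Fin NRF) ℂ)
    (FBB : Matrix (Fin NRF) (Fin Ns) ℂ) (n : Fin Nt) : ℂ :=
  (∫ s, amplifier M β (beamformed FRF FBB s n) * star (beamformed FRF FBB s n) ∂(symbolLaw Ns)) /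
    ((∫ s, ‖beamformed FRF FBB s n‖ ^ 2 ∂(symbolLaw Ns) : ℝ) : ℂ)

/-- The nonlinear distortion `d = x - G u`, where `G` is the diagonal matrix of average linear
gains. -/
def distortion (M : ℕ) (β : ℕ → ℂ) (FRF : Matrix (Fin Nt) (Fin NRF) ℂ)
    (FBB : Matrix (Fin NRF) (Fin Ns) ℂ) (s : Fin Ns → ℂ) : Fin Nt → ℂ := fun n =>
  amplifier M β (beamformed FRF FBB s n) - linearGain M β FRF FBB n * beamformed FRF FBB s n

/-- The covariance matrix `C_d = E{d dᴴ}` of the (zero-mean) distortion. -/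
def distortionCov (M : ℕ) (β : ℕ → ℂ) (FRF : Matrix (Fin Nt) (Fin NRF) ℂ)
    (FBB : Matrix (Fin NRF) (Fin Ns) ℂ) : Matrix (Fin Nt) (Fin Nt) ℂ :=
  Matrix.of fun k j =>
    ∫ s, distortion M β FRF FBB s k * star (distortion M β FRF FBB s j) ∂(symbolLaw Ns)

/-- The covariance matrix `G C_u Gᴴ` of the transmitted desired signal. -/
def desiredCov (M : ℕ) (β : ℕ → ℂ) (FRF : Matrix (Fin Nt) (Fin NRF) ℂ)
    (FBB : Matrix (Fin NRF) (Fin Ns) ℂ) : Matrix (Fin Nt) (Fin Nt) ℂ :=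
  diagonal (linearGain M β FRF FBB) * inputCov FRF FBB * (diagonal (linearGain M β FRF FBB))ᴴ

/-! ### Spectral efficiency -/

/-- The (worst case) spectral efficiency
`log₂ det (I + (H C_d Hᴴ + σ² I)⁻¹ H (G C_u Gᴴ) Hᴴ)`. The determinant is a positive real. -/
def spectralEfficiency {Nr : ℕ} (H : Matrix (Fin Nr) (Fin Nt) ℂ) (M : ℕ) (β : ℕ → ℂ) (σ : ℝ)
    (FRF : Matrix (Fin Nt) (Fin NRF) ℂ) (FBB : Matrix (Fin NRF) (Fin Ns) ℂ) : ℝ :=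
  Real.logb 2 (det (1 + (H * distortionCov M β FRF FBB * Hᴴ + ((σ ^ 2 : ℝ) : ℂ) • 1)⁻¹ *
    (H * desiredCov M β FRF FBB * Hᴴ))).re

end Transmitter

/-- The spectral efficiencies of all beamformers with `NRF` RF chains and `Ns` streams whose
analog part is a phase-shifter network (entries of modulus `√(1 / N_t)`) and whose total input
power into the amplification stage is `P`. -/
def feasibleSE {Nt Nr : ℕ} (NRF Ns : ℕ) (H : Matrix (Fin Nr) (Fin Nt) ℂ) (M : ℕ) (β : ℕ → ℂ)
    (σ P : ℝ) : Set ℝ :=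
  {r | ∃ (FRF : Matrix (Fin Nt) (Fin NRF) ℂ) (FBB : Matrix (Fin NRF) (Fin Ns) ℂ),
    (∀ i j, ‖FRF i j‖ = Real.sqrt (1 / Nt)) ∧ inputPower FRF FBB = P ∧
      r = spectralEfficiency H M β σ FRF FBB}

/-- The maximal spectral efficiency at total input power `P`. -/
def maxSE {Nt Nr : ℕ} (NRF Ns : ℕ) (H : Matrix (Fin Nr) (Fin Nt) ℂ) (M : ℕ) (β : ℕ → ℂ)
    (σ P : ℝ) : ℝ :=
  sSup (feasibleSE NRF Ns H M β σ P)

/-! ### The scalar functions in the bound -/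

/-- `g(p) = ∑_{m=0}^{M} β_{2m+1} p^m (m+1)!`. -/
def gBar (M : ℕ) (β : ℕ → ℂ) (p : ℝ) : ℂ :=
  ∑ m ∈ Finset.range (M + 1), β (2 * m + 1) * (p : ℂ) ^ m * ((m + 1).factorial : ℂ)

/-- `γ_m(p) = (m+1)^{-1/2} ∑_{q=m}^{M} β_{2q+1} (q choose m) (q+1)! p^{q-m}`. -/
def gammaCoeff (M : ℕ) (β : ℕ → ℂ) (m : ℕ) (p : ℝ) : ℂ :=
  ((Real.sqrt (1 / ((m : ℝ) + 1)) : ℝ) : ℂ) * ∑ q ∈ Finset.Icc m M,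
    β (2 * q + 1) * (q.choose m : ℂ) * ((q + 1).factorial : ℂ) * (p : ℂ) ^ (q - m)

/-- `g_s(p) = |g(p)|²`. -/
def gS (M : ℕ) (β : ℕ → ℂ) (p : ℝ) : ℝ := ‖gBar M β p‖ ^ 2

/-- `g_d(p) = ∑_{m=1}^{M} |γ_m(p)|² p^{2m}`. -/
def gD (M : ℕ) (β : ℕ → ℂ) (p : ℝ) : ℝ :=
  ∑ m ∈ Finset.Icc 1 M, ‖gammaCoeff M β m p‖ ^ 2 * p ^ (2 * m)

/-- `log₂ det (I + (h hᴴ g_d(P/N_t) + (σ²/P) I)⁻¹ h hᴴ g_s(P/N_t))`: the closed form in which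
`h` is the effective channel `H a`, for a unit-norm transmit beam `a`. -/
def closedFormSE {Nt Nr : ℕ} (H : Matrix (Fin Nr) (Fin Nt) ℂ) (a : Fin Nt → ℂ) (M : ℕ)
    (β : ℕ → ℂ) (σ P : ℝ) : ℝ :=
  Real.logb 2 (det (1 +
    ((gD M β (P / Nt) : ℂ) • vecMulVec (H *ᵥ a) (star (H *ᵥ a)) +
      ((σ ^ 2 / P : ℝ) : ℂ) • 1)⁻¹ *
    ((gS M β (P / Nt) : ℂ) • vecMulVec (H *ᵥ a) (star (H *ᵥ a))))).re

/-- The effective channel gain `|bᴴ H a|²` between unit-norm vectors `a` and `b`. -/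
def effectiveGain {Nt Nr : ℕ} (H : Matrix (Fin Nr) (Fin Nt) ℂ) (b : Fin Nr → ℂ)
    (a : Fin Nt → ℂ) : ℝ :=
  ‖star b ⬝ᵥ (H *ᵥ a)‖ ^ 2

/-- `log₂ (1 + g_s(P/N_t) / (g_d(P/N_t) + σ² / (δ P)))`; for `δ = 0`, where `σ² / (δ P)` is
infinite, the value is `log₂ 1 = 0`. -/
def rateLowerBound (Nt M : ℕ) (β : ℕ → ℂ) (σ P δ : ℝ) : ℝ :=
  if δ = 0 then 0
  else Real.logb 2 (1 + gS M β (P / Nt) / (gD M β (P / Nt) + σ ^ 2 / (δ * P)))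

end MmWave

end

open MmWave

namespace MmWave

/-! ### Moments of the symbol -/

/-! With one RF chain and one stream every antenna input is `c_n z`, with a common symbol `z` and
the same power `|c_n|² = P/Nt`. The amplifier then multiplies all inputs by the same random gain
`A(z)`, which depends only on `|z|`. So all linear gains equal `gBar`, the distortion is `(A(z) -
gBar) u`, and the desired and distortion covariances are both multiples of `a aᴴ`, where `a` is the
analog beam, with factors `P gS` and `P gD`.

The factor `gD` comes from the moments `E|z|^{2k} = k!`: `E|A|²|z|²` is a quadratic form in the
coefficients with kernel `(q+r+1)!`, and Vandermonde's identity diagonalizes this kernel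
(`sum_choose_mul_choose_mul_factorial`). The diagonal form is a sum of squares whose `m = 0` term is
`|gBar|²`, so subtracting the linear part leaves `gD`.

A rank-one determinant turns the spectral efficiency into `beamRate` at `t = ‖H a‖²`, which is
nondecreasing in `t`. The maximum is therefore attained where `‖H a‖²` is largest on a compact
torus, the closed form is the value at the steering beam, and the lower bound is the value at `δ`,
with `δ ≤ ‖H a_t‖²` by Cauchy–Schwarz. For one path `H` has rank at most one and all three powers
coincide. -/

/-- Two real Gaussian densities of variance `1/2` multiply to `π⁻¹ exp(-|z|²)`, and `ℂ ≃ ℝ × ℝ`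
preserves volume. -/
theorem integral_stdComplexGaussian (f : ℂ → ℝ) :
    ∫ z, f z ∂stdComplexGaussian = ∫ z : ℂ, Real.pi⁻¹ * Real.exp (-‖z‖ ^ 2) * f z := by
  have hv : (1 / 2 : NNReal) ≠ 0 := by norm_num
  have hmap : (fun p : ℝ × ℝ => (⟨p.1, p.2⟩ : ℂ)) = Complex.measurableEquivRealProd.symm := rfl
  have hden : (volume : Measure (ℝ × ℝ)) = (volume : Measure ℝ).prod volume := rfl
  have hmeas : Measurable fun p : ℝ × ℝ => gaussianPDF 0 (1 / 2) p.1 * gaussianPDF 0 (1 / 2) p.2 :=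
    ((measurable_gaussianPDF _ _).comp measurable_fst).mul
      ((measurable_gaussianPDF _ _).comp measurable_snd)
  rw [stdComplexGaussian, hmap, integral_map_equiv, gaussianReal_of_var_ne_zero _ hv,
    prod_withDensity (measurable_gaussianPDF _ _) (measurable_gaussianPDF _ _), ← hden,
    integral_withDensity_eq_integral_toReal_smul hmeas
      (Filter.Eventually.of_forall fun p => by simp [gaussianPDF, ENNReal.mul_lt_top]),
    ← (Complex.volume_preserving_equiv_real_prod.symm).integral_comp
      Complex.measurableEquivRealProd.symm.measurableEmbedding]
  refine integral_congr_ae (Filter.Eventually.of_forall fun p => ?_)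
  have hn : ‖(⟨p.1, p.2⟩ : ℂ)‖ ^ 2 = p.1 ^ 2 + p.2 ^ 2 := by
    rw [Complex.sq_norm, Complex.normSq_mk]; ring
  have hs : (Real.sqrt Real.pi)⁻¹ * (Real.sqrt Real.pi)⁻¹ = Real.pi⁻¹ := by
    rw [← mul_inv, Real.mul_self_sqrt Real.pi_pos.le]
  simp only [Complex.measurableEquivRealProd_symm_apply, smul_eq_mul, ENNReal.toReal_mul,
    toReal_gaussianPDF, gaussianPDFReal, hn]
  congr 1
  have h2 : (2 : ℝ) * Real.pi * ((1 / 2 : NNReal) : ℝ) = Real.pi := by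
    push_cast; ring
  have h3 : (2 : ℝ) * ((1 / 2 : NNReal) : ℝ) = 1 := by
    push_cast; ring
  rw [h2, h3, neg_add, Real.exp_add, ← hs]
  simp only [sub_zero, div_one]
  ring

theorem integral_norm_pow_stdComplexGaussian (k : ℕ) :
    ∫ z, ‖z‖ ^ (2 * k) ∂stdComplexGaussian = k.factorial := by
  rw [integral_stdComplexGaussian]
  have h := Complex.integral_rpow_mul_exp_neg_rpow (p := 2) (q := ((2 * k : ℕ) : ℝ)) one_le_two
    (by push_cast; linarith [(Nat.cast_nonneg k : (0 : ℝ) ≤ k)])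
  have hg : (((2 * k : ℕ) : ℝ) + 2) / 2 = (k : ℝ) + 1 := by push_cast; ring
  rw [hg, Real.Gamma_nat_eq_factorial] at h
  have hfun : (fun z : ℂ => Real.pi⁻¹ * Real.exp (-‖z‖ ^ 2) * ‖z‖ ^ (2 * k)) =
      fun z : ℂ => Real.pi⁻¹ *
        (‖z‖ ^ (((2 * k : ℕ) : ℝ)) * Real.exp (-‖z‖ ^ (2 : ℝ))) := by
    funext z
    rw [Real.rpow_natCast, Real.rpow_two]
    ring
  rw [hfun, integral_const_mul, h]
  have := Real.pi_ne_zero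
  field_simp

theorem integrable_norm_pow_stdComplexGaussian (k : ℕ) :
    Integrable (fun z : ℂ => ‖z‖ ^ (2 * k)) stdComplexGaussian := by
  by_contra h
  -- A non-integrable function has Bochner integral `0` by convention, but the integral is `k! ≠ 0`.
  have h0 := integral_undef h
  rw [integral_norm_pow_stdComplexGaussian] at h0
  exact k.factorial_ne_zero (by exact_mod_cast h0)

theorem integral_symbolLaw_one {E : Type*} [NormedAddCommGroup E] [NormedSpace ℝ E]
    (f : ℂ → E) : ∫ s, f (s 0) ∂(symbolLaw 1) = ∫ z, f z ∂stdComplexGaussian := by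
  have : SigmaFinite stdComplexGaussian := by
    have : IsProbabilityMeasure stdComplexGaussian :=
      Measure.isProbabilityMeasure_map Complex.measurableEquivRealProd.symm.measurable.aemeasurable
    infer_instance
  have h := measurePreserving_funUnique stdComplexGaussian (Fin 1)
  exact h.integral_comp (MeasurableEquiv.funUnique (Fin 1) ℂ).measurableEmbedding f

theorem integral_ofReal_norm_pow_stdComplexGaussian (k : ℕ) :
    ∫ z, (‖z‖ : ℂ) ^ (2 * k) ∂stdComplexGaussian = k.factorial := by
  have h : ∀ z : ℂ, (‖z‖ : ℂ) ^ (2 * k) = ((‖z‖ ^ (2 * k) : ℝ) : ℂ) := fun z => by push_cast; rfl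
  simp_rw [h]
  rw [integral_complex_ofReal, integral_norm_pow_stdComplexGaussian]
  simp

theorem integrable_ofReal_norm_pow_stdComplexGaussian (k : ℕ) :
    Integrable (fun z : ℂ => (‖z‖ : ℂ) ^ (2 * k)) stdComplexGaussian := by
  simpa using (integrable_norm_pow_stdComplexGaussian k).ofReal (𝕜 := ℂ)

/-! ### The amplifier's gain on a stream of power `p` -/

/-- The gain `∑_m β_{2m+1} p^m |z|^{2m}` seen by an antenna whose input is `c z`, `|c|² = p`. -/
noncomputable def amplifierGain (M : ℕ) (β : ℕ → ℂ) (p : ℝ) (z : ℂ) : ℂ :=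
  ∑ m ∈ Finset.range (M + 1), β (2 * m + 1) * (p : ℂ) ^ m * (‖z‖ : ℂ) ^ (2 * m)

/-- The gain depends on `c` only through `|c|²`, so antennas of equal power share it whatever their
phases. -/
theorem amplifier_mul (M : ℕ) (β : ℕ → ℂ) {p : ℝ} {c : ℂ} (hc : ‖c‖ ^ 2 = p) (z : ℂ) :
    amplifier M β (c * z) = amplifierGain M β p z * (c * z) := by
  rw [amplifier, amplifierGain, Finset.sum_mul]
  refine Finset.sum_congr rfl fun m _ => ?_
  have : ((‖c * z‖ : ℝ) : ℂ) ^ (2 * m) = (p : ℂ) ^ m * (‖z‖ : ℂ) ^ (2 * m) := by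
    rw [norm_mul, ← hc]
    push_cast
    rw [mul_pow, pow_mul (‖c‖ : ℂ)]
  rw [this]
  ring

theorem amplifierGain_mul_norm_sq (M : ℕ) (β : ℕ → ℂ) (p : ℝ) (z : ℂ) :
    amplifierGain M β p z * (‖z‖ : ℂ) ^ 2 =
      ∑ m ∈ Finset.range (M + 1), β (2 * m + 1) * (p : ℂ) ^ m * (‖z‖ : ℂ) ^ (2 * (m + 1)) := by
  rw [amplifierGain, Finset.sum_mul]
  exact Finset.sum_congr rfl fun m _ => by ring

theorem integrable_amplifierGain_mul_norm_sq (M : ℕ) (β : ℕ → ℂ) (p : ℝ) :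
    Integrable (fun z => amplifierGain M β p z * (‖z‖ : ℂ) ^ 2) stdComplexGaussian := by
  simp_rw [amplifierGain_mul_norm_sq]
  exact integrable_finsetSum _ fun m _ =>
    (integrable_ofReal_norm_pow_stdComplexGaussian (m + 1)).const_mul _

theorem integral_amplifierGain_mul_norm_sq (M : ℕ) (β : ℕ → ℂ) (p : ℝ) :
    ∫ z, amplifierGain M β p z * (‖z‖ : ℂ) ^ 2 ∂stdComplexGaussian = gBar M β p := by
  simp_rw [amplifierGain_mul_norm_sq]
  rw [integral_finsetSum _ fun m _ =>
    (integrable_ofReal_norm_pow_stdComplexGaussian (m + 1)).const_mul _, gBar]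
  refine Finset.sum_congr rfl fun m _ => ?_
  rw [integral_const_mul, integral_ofReal_norm_pow_stdComplexGaussian]

theorem amplifierGain_mul_star_mul_norm_sq (M : ℕ) (β : ℕ → ℂ) (p : ℝ) (z : ℂ) :
    amplifierGain M β p z * star (amplifierGain M β p z) * (‖z‖ : ℂ) ^ 2 =
      ∑ q ∈ Finset.range (M + 1), ∑ r ∈ Finset.range (M + 1),
        β (2 * q + 1) * star (β (2 * r + 1)) * (p : ℂ) ^ (q + r) *
          (‖z‖ : ℂ) ^ (2 * (q + r + 1)) := by
  rw [amplifierGain, star_sum, Finset.sum_mul_sum, Finset.sum_mul]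
  refine Finset.sum_congr rfl fun q _ => ?_
  rw [Finset.sum_mul]
  refine Finset.sum_congr rfl fun r _ => ?_
  simp only [star_mul', star_pow, Complex.star_def, Complex.conj_ofReal]
  ring

theorem integrable_amplifierGain_mul_star_mul_norm_sq (M : ℕ) (β : ℕ → ℂ) (p : ℝ) :
    Integrable (fun z => amplifierGain M β p z * star (amplifierGain M β p z) * (‖z‖ : ℂ) ^ 2)
      stdComplexGaussian := by
  simp_rw [amplifierGain_mul_star_mul_norm_sq]
  exact integrable_finsetSum _ fun q _ => integrable_finsetSum _ fun r _ =>
    (integrable_ofReal_norm_pow_stdComplexGaussian (q + r + 1)).const_mul _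

theorem integral_amplifierGain_mul_star_mul_norm_sq (M : ℕ) (β : ℕ → ℂ) (p : ℝ) :
    ∫ z, amplifierGain M β p z * star (amplifierGain M β p z) * (‖z‖ : ℂ) ^ 2
        ∂stdComplexGaussian =
      ∑ q ∈ Finset.range (M + 1), ∑ r ∈ Finset.range (M + 1),
        β (2 * q + 1) * star (β (2 * r + 1)) * (p : ℂ) ^ (q + r) *
          ((q + r + 1).factorial : ℂ) := by
  simp_rw [amplifierGain_mul_star_mul_norm_sq]
  rw [integral_finsetSum _ fun q _ => integrable_finsetSum _ fun r _ =>
    (integrable_ofReal_norm_pow_stdComplexGaussian (q + r + 1)).const_mul _]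
  refine Finset.sum_congr rfl fun q _ => ?_
  rw [integral_finsetSum _ fun r _ =>
    (integrable_ofReal_norm_pow_stdComplexGaussian (q + r + 1)).const_mul _]
  refine Finset.sum_congr rfl fun r _ => ?_
  rw [integral_const_mul, integral_ofReal_norm_pow_stdComplexGaussian]

/-! ### Orthogonal expansion of the output power -/

/-- Vandermonde's identity after `C(r+1, m+1) = C(r+1, r-m)`; the terms with `m > r` vanish. -/
theorem sum_choose_mul_choose_succ {q r M : ℕ} (hr : r ≤ M) :
    ∑ m ∈ Finset.range (M + 1), q.choose m * (r + 1).choose (m + 1) =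
      (q + r + 1).choose r := by
  have h := Nat.add_choose_eq q (r + 1) r
  rw [Finset.Nat.sum_antidiagonal_eq_sum_range_succ_mk] at h
  rw [add_assoc, h]
  symm
  refine Finset.sum_subset_zero_on_sdiff (Finset.range_mono (by omega)) (fun m hm => ?_)
    fun m hm => ?_
  · simp only [Finset.mem_sdiff, Finset.mem_range] at hm
    rw [Nat.choose_eq_zero_of_lt (show r + 1 < m + 1 by omega), mul_zero]
  · simp only [Finset.mem_range] at hm
    dsimp only
    rw [← Nat.choose_symm (show m + 1 ≤ r + 1 by omega)]
    congr 2
    omega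

/-- Since `(r+1)! C(r,m) / (m+1) = r! C(r+1, m+1)`, the sum is `r! (q+1)! C(q+r+1, r)`. It factors
the moment kernel `(q+r+1)!` as a Gram matrix. -/
theorem sum_choose_mul_choose_mul_factorial {q r M : ℕ} (hr : r ≤ M) :
    ∑ m ∈ Finset.range (M + 1), (1 / ((m : ℂ) + 1)) *
        ((q.choose m : ℂ) * ((q + 1).factorial : ℂ)) *
        ((r.choose m : ℂ) * ((r + 1).factorial : ℂ)) = ((q + r + 1).factorial : ℂ) := by
  have h1 : (q + r + 1).choose r * r.factorial * (q + 1).factorial = (q + r + 1).factorial := by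
    have := Nat.choose_mul_factorial_mul_factorial (show r ≤ q + r + 1 by omega)
    rwa [show q + r + 1 - r = q + 1 by omega] at this
  rw [← h1, ← sum_choose_mul_choose_succ (q := q) hr]
  push_cast
  rw [Finset.sum_mul, Finset.sum_mul]
  refine Finset.sum_congr rfl fun m _ => ?_
  have h2 : ((r : ℂ) + 1) * (r.choose m : ℂ) = ((r + 1).choose (m + 1) : ℂ) * ((m : ℂ) + 1) := by
    exact_mod_cast Nat.add_one_mul_choose_eq r m
  have hm : (m : ℂ) + 1 ≠ 0 := by exact_mod_cast m.succ_ne_zero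
  rw [Nat.factorial_succ r]
  push_cast
  field_simp
  linear_combination (q.choose m : ℂ) * ((q + 1).factorial : ℂ) * (r.factorial : ℂ) * h2

theorem gammaCoeff_mul_pow (M : ℕ) (β : ℕ → ℂ) (m : ℕ) (p : ℝ) :
    gammaCoeff M β m p * (p : ℂ) ^ m = ((Real.sqrt (1 / ((m : ℝ) + 1)) : ℝ) : ℂ) *
      ∑ q ∈ Finset.range (M + 1),
        β (2 * q + 1) * (p : ℂ) ^ q * ((q.choose m : ℂ) * ((q + 1).factorial : ℂ)) := by
  rw [gammaCoeff, mul_assoc, Finset.sum_mul]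
  congr 1
  -- The sum extends from `q ≥ m` to all `q`, because `q.choose m = 0` for `q < m`; this also avoids
  -- the truncated exponent `q - m`.
  refine Finset.sum_subset_zero_on_sdiff (fun q hq => ?_) (fun q hq => ?_) fun q hq => ?_
  · simp only [Finset.mem_Icc, Finset.mem_range] at hq ⊢
    omega
  · simp only [Finset.mem_sdiff, Finset.mem_Icc, Finset.mem_range] at hq
    rw [Nat.choose_eq_zero_of_lt (show q < m by omega)]
    simp
  · simp only [Finset.mem_Icc] at hq
    rw [← pow_sub_mul_pow (p : ℂ) hq.1]
    ring

/-- The right side is `E|A|²|z|²`; this is its diagonalization by the Gram factorization of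
`(q+r+1)!`. -/
theorem sum_norm_gammaCoeff_sq (M : ℕ) (β : ℕ → ℂ) (p : ℝ) :
    ((∑ m ∈ Finset.range (M + 1), ‖gammaCoeff M β m p‖ ^ 2 * p ^ (2 * m) : ℝ) : ℂ) =
      ∑ q ∈ Finset.range (M + 1), ∑ r ∈ Finset.range (M + 1),
        β (2 * q + 1) * star (β (2 * r + 1)) * (p : ℂ) ^ (q + r) *
          ((q + r + 1).factorial : ℂ) := by
  have hterm : ∀ m : ℕ, ((‖gammaCoeff M β m p‖ ^ 2 * p ^ (2 * m) : ℝ) : ℂ) =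
      ∑ q ∈ Finset.range (M + 1), ∑ r ∈ Finset.range (M + 1),
        (β (2 * q + 1) * star (β (2 * r + 1)) * (p : ℂ) ^ (q + r)) *
        ((1 / ((m : ℂ) + 1)) * ((q.choose m : ℂ) * ((q + 1).factorial : ℂ)) *
          ((r.choose m : ℂ) * ((r + 1).factorial : ℂ))) := by
    intro m
    have h1 : ((‖gammaCoeff M β m p‖ ^ 2 * p ^ (2 * m) : ℝ) : ℂ) =
        (gammaCoeff M β m p * (p : ℂ) ^ m) * star (gammaCoeff M β m p * (p : ℂ) ^ m) := by
      rw [star_mul', star_pow, Complex.star_def, Complex.conj_ofReal]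
      have := Complex.mul_conj' (gammaCoeff M β m p)
      push_cast
      rw [← this]
      ring
    have hs : ((Real.sqrt (1 / ((m : ℝ) + 1)) : ℝ) : ℂ) *
        ((Real.sqrt (1 / ((m : ℝ) + 1)) : ℝ) : ℂ) = 1 / ((m : ℂ) + 1) := by
      rw [← Complex.ofReal_mul, Real.mul_self_sqrt (by positivity)]
      push_cast
      rfl
    rw [h1, gammaCoeff_mul_pow, star_mul', Complex.star_def, Complex.conj_ofReal,
      mul_mul_mul_comm, hs, map_sum, Finset.sum_mul_sum, Finset.mul_sum]
    refine Finset.sum_congr rfl fun q _ => ?_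
    rw [Finset.mul_sum]
    refine Finset.sum_congr rfl fun r _ => ?_
    simp only [map_mul, map_pow, Complex.conj_ofReal, map_natCast]
    ring
  rw [Complex.ofReal_sum, Finset.sum_congr rfl fun m _ => hterm m, Finset.sum_comm]
  refine Finset.sum_congr rfl fun q _ => ?_
  rw [Finset.sum_comm]
  refine Finset.sum_congr rfl fun r hr => ?_
  rw [← Finset.mul_sum,
    sum_choose_mul_choose_mul_factorial (Nat.lt_succ_iff.mp (Finset.mem_range.mp hr))]

theorem gammaCoeff_zero (M : ℕ) (β : ℕ → ℂ) (p : ℝ) : gammaCoeff M β 0 p = gBar M β p := by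
  have h := gammaCoeff_mul_pow M β 0 p
  simp only [pow_zero, mul_one, Nat.choose_zero_right, Nat.cast_one, one_mul, Nat.cast_zero,
    zero_add, div_one, Real.sqrt_one, Complex.ofReal_one] at h
  rw [h, gBar]

theorem gS_add_gD (M : ℕ) (β : ℕ → ℂ) (p : ℝ) :
    gS M β p + gD M β p =
      ∑ m ∈ Finset.range (M + 1), ‖gammaCoeff M β m p‖ ^ 2 * p ^ (2 * m) := by
  have hI : Finset.range (M + 1) = insert 0 (Finset.Icc 1 M) := by
    ext m
    simp only [Finset.mem_range, Finset.mem_insert, Finset.mem_Icc]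
    omega
  rw [hI, Finset.sum_insert (by simp), gammaCoeff_zero, gS, gD]
  simp

theorem gD_nonneg (M : ℕ) (β : ℕ → ℂ) (p : ℝ) : 0 ≤ gD M β p :=
  Finset.sum_nonneg fun m _ => mul_nonneg (sq_nonneg _) ((even_two_mul m).pow_nonneg p)

/-- Expanding the square with `E A|z|² = g` and `E|z|² = 1` gives `E|A|²|z|² - |g|²`, and `|g|²` is
exactly the `m = 0` term of the expansion. -/
theorem integral_distortionGain (M : ℕ) (β : ℕ → ℂ) (p : ℝ) :
    ∫ z, (amplifierGain M β p z - gBar M β p) * star (amplifierGain M β p z - gBar M β p) *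
      (‖z‖ : ℂ) ^ 2 ∂stdComplexGaussian = gD M β p := by
  set g := gBar M β p with hg
  have hcongr : ∀ z : ℂ, (amplifierGain M β p z - g) * star (amplifierGain M β p z - g) *
      (‖z‖ : ℂ) ^ 2 =
      amplifierGain M β p z * star (amplifierGain M β p z) * (‖z‖ : ℂ) ^ 2 -
        star g * (amplifierGain M β p z * (‖z‖ : ℂ) ^ 2) -
        (g * star (amplifierGain M β p z * (‖z‖ : ℂ) ^ 2) - g * star g * (‖z‖ : ℂ) ^ (2 * 1)) := by
    intro z
    simp only [star_mul', star_pow, star_sub, Complex.star_def, Complex.conj_ofReal]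
    ring
  have i1 := integrable_amplifierGain_mul_star_mul_norm_sq M β p
  have i2 := integrable_amplifierGain_mul_norm_sq M β p
  have i3 : Integrable (fun z => star (amplifierGain M β p z * (‖z‖ : ℂ) ^ 2))
      stdComplexGaussian := Complex.conjCLE.toContinuousLinearMap.integrable_comp i2
  have i4 := integrable_ofReal_norm_pow_stdComplexGaussian 1
  have j12 : Integrable (fun z => amplifierGain M β p z * star (amplifierGain M β p z) *
      (‖z‖ : ℂ) ^ 2 - star g * (amplifierGain M β p z * (‖z‖ : ℂ) ^ 2)) stdComplexGaussian :=
    i1.sub (i2.const_mul _)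
  have j34 : Integrable (fun z => g * star (amplifierGain M β p z * (‖z‖ : ℂ) ^ 2) -
      g * star g * (‖z‖ : ℂ) ^ (2 * 1)) stdComplexGaussian :=
    (i3.const_mul _).sub (i4.const_mul _)
  have e3 : ∫ z, star (amplifierGain M β p z * (‖z‖ : ℂ) ^ 2) ∂stdComplexGaussian = star g := by
    rw [hg, ← integral_amplifierGain_mul_norm_sq]
    exact integral_conj
  simp_rw [hcongr]
  rw [integral_sub j12 j34,
    integral_sub i1 (i2.const_mul _), integral_sub (i3.const_mul _) (i4.const_mul _),
    integral_const_mul, integral_const_mul, integral_const_mul, e3,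
    integral_amplifierGain_mul_norm_sq, integral_ofReal_norm_pow_stdComplexGaussian,
    integral_amplifierGain_mul_star_mul_norm_sq, ← sum_norm_gammaCoeff_sq, ← gS_add_gD, gS]
  have hgg := Complex.mul_conj' g
  push_cast
  rw [← hg, ← hgg, Complex.star_def]
  simp
  ring

/-! ### Rank-one determinants -/

theorem det_one_add_vecMulVec {n : Type*} [Fintype n] [DecidableEq n] (u v : n → ℂ) :
    det (1 + vecMulVec u v) = 1 + v ⬝ᵥ u := by
  rw [vecMulVec_eq Unit, det_one_add_replicateCol_mul_replicateRow]

/-- The squared Euclidean norm of a complex vector. -/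
noncomputable def normSqVec {n : Type*} [Fintype n] (v : n → ℂ) : ℝ := ∑ i, ‖v i‖ ^ 2

theorem normSqVec_nonneg {n : Type*} [Fintype n] (v : n → ℂ) : 0 ≤ normSqVec v :=
  Finset.sum_nonneg fun _ _ => sq_nonneg _

theorem star_dotProduct_self {n : Type*} [Fintype n] (v : n → ℂ) :
    star v ⬝ᵥ v = (normSqVec v : ℂ) := by
  rw [dotProduct, normSqVec]
  push_cast
  exact Finset.sum_congr rfl fun i _ => Complex.conj_mul' (v i)

theorem normSqVec_smul {n : Type*} [Fintype n] (c : ℂ) (v : n → ℂ) :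
    normSqVec (c • v) = ‖c‖ ^ 2 * normSqVec v := by
  simp [normSqVec, mul_pow, Finset.mul_sum]

/-- The Cauchy-Schwarz inequality. -/
theorem norm_star_dotProduct_sq_le {n : Type*} [Fintype n] (v w : n → ℂ) :
    ‖star v ⬝ᵥ w‖ ^ 2 ≤ normSqVec v * normSqVec w := by
  have h : ‖star v ⬝ᵥ w‖ ≤ ∑ i, ‖v i‖ * ‖w i‖ := by
    refine (norm_sum_le _ _).trans_eq (Finset.sum_congr rfl fun i _ => ?_)
    simp
  calc ‖star v ⬝ᵥ w‖ ^ 2 ≤ (∑ i, ‖v i‖ * ‖w i‖) ^ 2 := by gcongr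
    _ ≤ _ := Finset.sum_mul_sq_le_sq_mul_sq _ _ _

/-- `v` satisfies `A v = (x‖v‖² + c) v`, so `A⁻¹` merely rescales it and the matrix determinant
lemma applies. -/
theorem det_one_add_inv_mul_vecMulVec {n : Type*} [Fintype n] [DecidableEq n] (v : n → ℂ)
    {x c : ℝ} (y : ℝ) (hx : 0 ≤ x) (hc : 0 < c) :
    det (1 + ((x : ℂ) • vecMulVec v (star v) + (c : ℂ) • 1)⁻¹ *
      ((y : ℂ) • vecMulVec v (star v))) =
      ((1 + y * normSqVec v / (x * normSqVec v + c) : ℝ) : ℂ) := by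
  set A : Matrix n n ℂ := (x : ℂ) • vecMulVec v (star v) + (c : ℂ) • 1 with hA
  set t := normSqVec v with ht
  have htv : star v ⬝ᵥ v = (t : ℂ) := star_dotProduct_self v
  have ht0 : 0 ≤ t := normSqVec_nonneg v
  have hpos : 0 < x * t + c := by positivity
  have hposC : ((x * t + c : ℝ) : ℂ) ≠ 0 := Complex.ofReal_ne_zero.mpr hpos.ne'
  have hcC : (c : ℂ) ≠ 0 := Complex.ofReal_ne_zero.mpr hc.ne'
  -- This form serves only to show `A` invertible, again by the rank-one determinant.
  have hAeq : A = (c : ℂ) • (1 + vecMulVec (((x / c : ℝ) : ℂ) • v) (star v)) := by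
    rw [hA, smul_add, add_comm, smul_vecMulVec, smul_smul]
    congr 2
    push_cast
    field_simp
  have hdet : IsUnit A.det := by
    rw [isUnit_iff_ne_zero, hAeq, det_smul, det_one_add_vecMulVec, dotProduct_smul, htv]
    refine mul_ne_zero (pow_ne_zero _ hcC) ?_
    have : (1 : ℂ) + ((x / c : ℝ) : ℂ) • (t : ℂ) = ((1 + x / c * t : ℝ) : ℂ) := by
      push_cast; rfl
    rw [this]
    exact Complex.ofReal_ne_zero.mpr (by positivity)
  have hAv : A *ᵥ v = ((x * t + c : ℝ) : ℂ) • v := by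
    rw [hA, add_mulVec, smul_mulVec, smul_mulVec, one_mulVec, vecMulVec_mulVec, htv]
    ext i
    simp
    ring
  have hinv : A⁻¹ *ᵥ v = ((x * t + c : ℝ) : ℂ)⁻¹ • v := by
    have h := congrArg (fun w => A⁻¹ *ᵥ w) hAv
    simp only [mulVec_mulVec, nonsing_inv_mul A hdet, one_mulVec, mulVec_smul] at h
    rw [h, smul_smul, inv_mul_cancel₀ hposC, one_smul, ← h]
  rw [← smul_vecMulVec, mul_vecMulVec, mulVec_smul, hinv, det_one_add_vecMulVec,
    dotProduct_smul, dotProduct_smul, htv]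
  push_cast
  simp only [smul_eq_mul]
  ring

/-! ### Spectral efficiency as a function of the received beam power -/

/-- The rate `log₂ (1 + g_s t / (g_d t + σ²/P))` as a function of the beam power `t` at the
receiver. -/
noncomputable def beamRate (Nt M : ℕ) (β : ℕ → ℂ) (σ P t : ℝ) : ℝ :=
  Real.logb 2 (1 + gS M β (P / Nt) * t / (gD M β (P / Nt) * t + σ ^ 2 / P))

theorem beamRate_le_beamRate (Nt M : ℕ) (β : ℕ → ℂ) {σ P s t : ℝ} (hσ : 0 < σ) (hP : 0 < P)
    (hs : 0 ≤ s) (hst : s ≤ t) : beamRate Nt M β σ P s ≤ beamRate Nt M β σ P t := by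
  have hd := gD_nonneg M β (P / Nt)
  have hg : 0 ≤ gS M β (P / Nt) := sq_nonneg _
  have ht := hs.trans hst
  have hc : 0 < σ ^ 2 / P := by positivity
  unfold beamRate
  refine Real.logb_le_logb_of_le one_lt_two (by positivity) ?_
  gcongr 1 + ?_
  rw [div_le_div_iff₀ (by positivity) (by positivity)]
  -- After cross-multiplication the two sides differ by `gS · (σ²/P) · (t - s)`.
  nlinarith [mul_le_mul_of_nonneg_left hst (mul_nonneg hg hc.le)]

theorem rateLowerBound_eq_beamRate (Nt M : ℕ) (β : ℕ → ℂ) {σ P δ : ℝ} (hσ : 0 < σ) (hP : 0 < P)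
    (hδ : 0 ≤ δ) : rateLowerBound Nt M β σ P δ = beamRate Nt M β σ P δ := by
  rw [rateLowerBound, beamRate]
  split_ifs with h
  · simp [h]
  · have hδ' : 0 < δ := lt_of_le_of_ne hδ (Ne.symm h)
    have hd := gD_nonneg M β (P / Nt)
    have h1 : 0 < gD M β (P / Nt) * δ + σ ^ 2 / P := by positivity
    have h2 : 0 < gD M β (P / Nt) + σ ^ 2 / (δ * P) := by positivity
    congr 2
    rw [div_eq_div_iff h2.ne' h1.ne']
    field_simp

theorem closedFormSE_eq_beamRate {Nt Nr : ℕ} (H : Matrix (Fin Nr) (Fin Nt) ℂ) (a : Fin Nt → ℂ)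
    (M : ℕ) (β : ℕ → ℂ) {σ P : ℝ} (hσ : 0 < σ) (hP : 0 < P) :
    closedFormSE H a M β σ P = beamRate Nt M β σ P (normSqVec (H *ᵥ a)) := by
  rw [closedFormSE, det_one_add_inv_mul_vecMulVec _ _ (gD_nonneg M β _) (by positivity),
    Complex.ofReal_re, beamRate]

/-! ### Covariances and spectral efficiency for a single RF chain -/

section SingleChain

variable {Nt : ℕ} (FRF : Matrix (Fin Nt) (Fin 1) ℂ) (FBB : Matrix (Fin 1) (Fin 1) ℂ)

theorem beamformed_apply_single (s : Fin 1 → ℂ) (n : Fin Nt) :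
    beamformed FRF FBB s n = FRF n 0 * FBB 0 0 * s 0 := by
  simp [beamformed, mulVec, dotProduct, mul_apply]

theorem integral_norm_sq_beamformed (n : Fin Nt) :
    ∫ s, ‖beamformed FRF FBB s n‖ ^ 2 ∂(symbolLaw 1) = ‖FRF n 0‖ ^ 2 * ‖FBB 0 0‖ ^ 2 := by
  simp_rw [beamformed_apply_single]
  rw [integral_symbolLaw_one fun z : ℂ => ‖FRF n 0 * FBB 0 0 * z‖ ^ 2]
  simp_rw [norm_mul, mul_pow]
  have := integral_norm_pow_stdComplexGaussian 1
  rw [integral_const_mul]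
  simp_all

variable {FRF FBB}

theorem inputPower_single (hNt : 0 < Nt) (hF : ∀ i j, ‖FRF i j‖ = Real.sqrt (1 / Nt)) :
    inputPower FRF FBB = ‖FBB 0 0‖ ^ 2 := by
  have hN : (Nt : ℝ) ≠ 0 := by exact_mod_cast hNt.ne'
  have hfun : ∀ s : Fin 1 → ℂ, ∑ n, ‖beamformed FRF FBB s n‖ ^ 2 = ‖FBB 0 0‖ ^ 2 * ‖s 0‖ ^ 2 := by
    intro s
    have : ∀ n, ‖beamformed FRF FBB s n‖ ^ 2 = 1 / Nt * (‖FBB 0 0‖ ^ 2 * ‖s 0‖ ^ 2) := by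
      intro n
      rw [beamformed_apply_single, norm_mul, norm_mul, hF, mul_pow, mul_pow,
        Real.sq_sqrt (by positivity), mul_assoc]
    rw [Finset.sum_congr rfl fun n _ => this n, Finset.sum_const, Finset.card_univ,
      Fintype.card_fin, nsmul_eq_mul]
    field_simp
  have h1 := integral_norm_pow_stdComplexGaussian 1
  rw [inputPower]
  simp_rw [hfun]
  rw [integral_symbolLaw_one fun z : ℂ => ‖FBB 0 0‖ ^ 2 * ‖z‖ ^ 2, integral_const_mul]
  simp_all

theorem inputCov_single : inputCov FRF FBB =
    ((‖FBB 0 0‖ ^ 2 : ℝ) : ℂ) • vecMulVec (fun n => FRF n 0) (star fun n => FRF n 0) := by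
  ext k j
  have h1 := integral_ofReal_norm_pow_stdComplexGaussian 1
  have hb := Complex.mul_conj' (FBB 0 0)
  simp only [inputCov, of_apply, beamformed_apply_single, Matrix.smul_apply, vecMulVec_apply,
    Pi.star_apply, smul_eq_mul]
  have hfun : ∀ z : ℂ, FRF k 0 * FBB 0 0 * z * star (FRF j 0 * FBB 0 0 * z) =
      ((‖FBB 0 0‖ ^ 2 : ℝ) : ℂ) * (FRF k 0 * star (FRF j 0)) * (‖z‖ : ℂ) ^ (2 * 1) := by
    intro z
    rw [mul_one, ← Complex.mul_conj' z]
    push_cast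
    rw [← hb]
    simp only [star_mul', Complex.star_def]
    ring
  simp_rw [hfun]
  rw [integral_symbolLaw_one fun z : ℂ => ((‖FBB 0 0‖ ^ 2 : ℝ) : ℂ) * (FRF k 0 * star (FRF j 0)) *
    (‖z‖ : ℂ) ^ (2 * 1), integral_const_mul, h1]
  simp

theorem linearGain_single (M : ℕ) (β : ℕ → ℂ) {p : ℝ} (hp : 0 < p) (n : Fin Nt)
    (hc : ‖FRF n 0 * FBB 0 0‖ ^ 2 = p) : linearGain M β FRF FBB n = gBar M β p := by
  have hpC : (p : ℂ) ≠ 0 := Complex.ofReal_ne_zero.mpr hp.ne'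
  have hcc := Complex.mul_conj' (FRF n 0 * FBB 0 0)
  have hfun : ∀ z : ℂ, amplifier M β (FRF n 0 * FBB 0 0 * z) * star (FRF n 0 * FBB 0 0 * z) =
      (p : ℂ) * (amplifierGain M β p z * (‖z‖ : ℂ) ^ 2) := by
    intro z
    rw [amplifier_mul M β hc, ← Complex.mul_conj' z, ← hc]
    push_cast
    rw [← hcc, star_mul', Complex.star_def]
    ring
  rw [linearGain, integral_norm_sq_beamformed, ← mul_pow, ← norm_mul, hc]
  simp_rw [beamformed_apply_single]
  rw [integral_symbolLaw_one fun z : ℂ =>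
    amplifier M β (FRF n 0 * FBB 0 0 * z) * star (FRF n 0 * FBB 0 0 * z)]
  simp_rw [hfun]
  rw [integral_const_mul, integral_amplifierGain_mul_norm_sq, mul_div_cancel_left₀ _ hpC]

theorem distortionCov_single (M : ℕ) (β : ℕ → ℂ) {p : ℝ} (hp : 0 < p)
    (hc : ∀ n, ‖FRF n 0 * FBB 0 0‖ ^ 2 = p) : distortionCov M β FRF FBB =
      ((gD M β p * ‖FBB 0 0‖ ^ 2 : ℝ) : ℂ) •
        vecMulVec (fun n => FRF n 0) (star fun n => FRF n 0) := by
  ext k j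
  have hb := Complex.mul_conj' (FBB 0 0)
  simp only [distortionCov, distortion, of_apply, beamformed_apply_single, Matrix.smul_apply,
    vecMulVec_apply, Pi.star_apply, smul_eq_mul, linearGain_single M β hp _ (hc _),
    amplifier_mul M β (hc _)]
  have hfun : ∀ z : ℂ, (amplifierGain M β p z * (FRF k 0 * FBB 0 0 * z) -
        gBar M β p * (FRF k 0 * FBB 0 0 * z)) *
      star (amplifierGain M β p z * (FRF j 0 * FBB 0 0 * z) -
        gBar M β p * (FRF j 0 * FBB 0 0 * z)) =
      ((‖FBB 0 0‖ ^ 2 : ℝ) : ℂ) * (FRF k 0 * star (FRF j 0)) *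
        ((amplifierGain M β p z - gBar M β p) * star (amplifierGain M β p z - gBar M β p) *
          (‖z‖ : ℂ) ^ 2) := by
    intro z
    rw [← Complex.mul_conj' z]
    push_cast
    rw [← hb]
    simp only [star_mul', star_sub, Complex.star_def]
    ring
  simp_rw [hfun]
  rw [integral_symbolLaw_one fun z : ℂ => ((‖FBB 0 0‖ ^ 2 : ℝ) : ℂ) * (FRF k 0 * star (FRF j 0)) *
        ((amplifierGain M β p z - gBar M β p) * star (amplifierGain M β p z - gBar M β p) *
          (‖z‖ : ℂ) ^ 2), integral_const_mul, integral_distortionGain]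
  push_cast
  ring

theorem desiredCov_single (M : ℕ) (β : ℕ → ℂ) {p : ℝ} (hp : 0 < p)
    (hc : ∀ n, ‖FRF n 0 * FBB 0 0‖ ^ 2 = p) : desiredCov M β FRF FBB =
      ((gS M β p * ‖FBB 0 0‖ ^ 2 : ℝ) : ℂ) •
        vecMulVec (fun n => FRF n 0) (star fun n => FRF n 0) := by
  have hl : linearGain M β FRF FBB = fun _ => gBar M β p :=
    funext fun n => linearGain_single M β hp n (hc n)
  have hg := Complex.mul_conj' (gBar M β p)
  ext k j
  rw [desiredCov, hl, inputCov_single, diagonal_conjTranspose, mul_diagonal, diagonal_mul]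
  simp only [Matrix.smul_apply, smul_eq_mul, Pi.star_apply, gS]
  push_cast
  rw [← hg, Complex.star_def]
  ring

/-- Both covariances carry the factor `P`; dividing it out turns the noise term `σ²` into `σ²/P`. -/
theorem spectralEfficiency_single {Nr : ℕ} (H : Matrix (Fin Nr) (Fin Nt) ℂ) (M : ℕ) (β : ℕ → ℂ)
    {σ P : ℝ} (hNt : 0 < Nt) (hσ : 0 < σ) (hP : 0 < P)
    (hF : ∀ i j, ‖FRF i j‖ = Real.sqrt (1 / Nt)) (hpow : inputPower FRF FBB = P) :
    spectralEfficiency H M β σ FRF FBB =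
      beamRate Nt M β σ P (normSqVec (H *ᵥ fun n => FRF n 0)) := by
  have hN : (0 : ℝ) < Nt := by exact_mod_cast hNt
  rw [inputPower_single hNt hF] at hpow
  have hc : ∀ n, ‖FRF n 0 * FBB 0 0‖ ^ 2 = P / Nt := by
    intro n
    rw [norm_mul, hF, mul_pow, Real.sq_sqrt (by positivity), hpow]
    ring
  have hp : 0 < P / Nt := by positivity
  have hconj : ∀ (c : ℂ) (a : Fin Nt → ℂ), H * (c • vecMulVec a (star a)) * Hᴴ =
      c • vecMulVec (H *ᵥ a) (star (H *ᵥ a)) := by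
    intro c a
    rw [Matrix.mul_smul, Matrix.smul_mul, mul_vecMulVec, vecMulVec_mul, star_mulVec]
  rw [spectralEfficiency, distortionCov_single M β hp hc, desiredCov_single M β hp hc, hconj,
    hconj, hpow, det_one_add_inv_mul_vecMulVec _ _ (mul_nonneg (gD_nonneg M β _) hP.le)
      (by positivity), Complex.ofReal_re, beamRate]
  set t := normSqVec (H *ᵥ fun n => FRF n 0) with ht
  have ht0 : 0 ≤ t := normSqVec_nonneg _
  have hd := gD_nonneg M β (P / Nt)
  congr 2
  rw [div_eq_div_iff (by positivity) (by positivity)]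
  field_simp

end SingleChain

/-! ### Phase-shifter beams -/

/-- The transmit beams that a single RF chain with a phase-shifter network can form. -/
def phaseBeams (N : ℕ) : Set (Fin N → ℂ) := {a | ∀ n, ‖a n‖ = Real.sqrt (1 / N)}

theorem isCompact_phaseBeams (N : ℕ) : IsCompact (phaseBeams N) := by
  have h : phaseBeams N = Set.univ.pi fun _ => Metric.sphere (0 : ℂ) (Real.sqrt (1 / N)) := by
    ext a
    simp [phaseBeams]
  rw [h]
  exact isCompact_univ_pi fun _ => isCompact_sphere _ _

theorem arrayResponse_mem_phaseBeams (N : ℕ) (D ω : ℝ) : arrayResponse N D ω ∈ phaseBeams N := by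
  intro n
  have h : -(Complex.I * ((2 * Real.pi * (n : ℕ) * D * Real.sin ω : ℝ) : ℂ)) =
      ((-(2 * Real.pi * (n : ℕ) * D * Real.sin ω) : ℝ) : ℂ) * Complex.I := by
    push_cast
    ring
  rw [arrayResponse, norm_mul, h, Complex.norm_exp_ofReal_mul_I, mul_one, Complex.norm_real,
    Real.norm_of_nonneg (by positivity), Real.sqrt_div zero_le_one, Real.sqrt_one]

theorem normSqVec_eq_one_of_mem_phaseBeams {N : ℕ} (hN : 0 < N) {a : Fin N → ℂ}
    (ha : a ∈ phaseBeams N) : normSqVec a = 1 := by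
  have hN' : (N : ℝ) ≠ 0 := by exact_mod_cast hN.ne'
  have : ∀ n, ‖a n‖ ^ 2 = 1 / N := fun n => by rw [ha n, Real.sq_sqrt (by positivity)]
  rw [normSqVec, Finset.sum_congr rfl fun n _ => this n, Finset.sum_const, Finset.card_univ,
    Fintype.card_fin, nsmul_eq_mul]
  field_simp

/-- The power constraint fixes `|FBB|² = P`, and its phase has no effect on the rate, so only the
analog beam remains free. -/
theorem feasibleSE_single {Nt Nr : ℕ} (H : Matrix (Fin Nr) (Fin Nt) ℂ) (M : ℕ) (β : ℕ → ℂ)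
    {σ P : ℝ} (hNt : 0 < Nt) (hσ : 0 < σ) (hP : 0 < P) :
    feasibleSE 1 1 H M β σ P =
      (fun a => beamRate Nt M β σ P (normSqVec (H *ᵥ a))) '' phaseBeams Nt := by
  ext r
  constructor
  · rintro ⟨FRF, FBB, hF, hpow, rfl⟩
    exact ⟨fun n => FRF n 0, fun n => hF n 0,
      (spectralEfficiency_single H M β hNt hσ hP hF hpow).symm⟩
  · rintro ⟨a, ha, rfl⟩
    have hF : ∀ i j, ‖(of fun n (_ : Fin 1) => a n) i j‖ = Real.sqrt (1 / Nt) := fun i _ => ha i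
    have hpow : inputPower (of fun n (_ : Fin 1) => a n)
        (of fun (_ _ : Fin 1) => ((Real.sqrt P : ℝ) : ℂ)) = P := by
      rw [inputPower_single hNt hF, of_apply, Complex.norm_real,
        Real.norm_of_nonneg (Real.sqrt_nonneg _), Real.sq_sqrt hP.le]
    exact ⟨_, _, hF, hpow, (spectralEfficiency_single H M β hNt hσ hP hF hpow).symm⟩

theorem exists_isMaxOn_phaseBeams {Nt Nr : ℕ} (H : Matrix (Fin Nr) (Fin Nt) ℂ) :
    ∃ a ∈ phaseBeams Nt, ∀ a' ∈ phaseBeams Nt, normSqVec (H *ᵥ a') ≤ normSqVec (H *ᵥ a) := by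
  have hcont : Continuous fun a : Fin Nt → ℂ => normSqVec (H *ᵥ a) := by
    unfold normSqVec
    have : Continuous fun a : Fin Nt → ℂ => H *ᵥ a := continuous_const.matrix_mulVec continuous_id
    fun_prop
  obtain ⟨a, ha, hmax⟩ := (isCompact_phaseBeams Nt).exists_isMaxOn
    -- Any array response witnesses that the torus is nonempty.
    ⟨_, arrayResponse_mem_phaseBeams Nt 0 0⟩ hcont.continuousOn
  exact ⟨a, ha, fun a' ha' => hmax ha'⟩

/-- Cauchy–Schwarz with the unit vector `b`: combining the receive antennas cannot gain power. -/
theorem effectiveGain_le {Nt Nr : ℕ} (hNr : 0 < Nr) (H : Matrix (Fin Nr) (Fin Nt) ℂ)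
    {b : Fin Nr → ℂ} (hb : b ∈ phaseBeams Nr) (a : Fin Nt → ℂ) :
    effectiveGain H b a ≤ normSqVec (H *ᵥ a) := by
  have h := norm_star_dotProduct_sq_le b (H *ᵥ a)
  rwa [normSqVec_eq_one_of_mem_phaseBeams hNr hb, one_mul] at h

/-- On a rank-one channel the matched beams attain the largest received power. -/
theorem rankOne_mulVec_le {Nt Nr : ℕ} (hNt : 0 < Nt) (hNr : 0 < Nr) (κ : ℂ)
    {b : Fin Nr → ℂ} (hb : b ∈ phaseBeams Nr) {a : Fin Nt → ℂ} (ha : a ∈ phaseBeams Nt) :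
    effectiveGain (κ • vecMulVec b (star a)) b a = ‖κ‖ ^ 2 ∧
      ∀ a' ∈ phaseBeams Nt, normSqVec ((κ • vecMulVec b (star a)) *ᵥ a') ≤ ‖κ‖ ^ 2 := by
  have hmul : ∀ a' : Fin Nt → ℂ,
      (κ • vecMulVec b (star a)) *ᵥ a' = (κ * (star a ⬝ᵥ a')) • b := by
    intro a'
    rw [smul_mulVec, vecMulVec_mulVec]
    ext i
    simp
    ring
  have hb1 := normSqVec_eq_one_of_mem_phaseBeams hNr hb
  have ha1 := normSqVec_eq_one_of_mem_phaseBeams hNt ha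
  refine ⟨?_, fun a' ha' => ?_⟩
  · rw [effectiveGain, hmul, dotProduct_smul, star_dotProduct_self, star_dotProduct_self, hb1, ha1]
    simp
  · rw [hmul, normSqVec_smul, hb1, mul_one, norm_mul, mul_pow]
    have h := norm_star_dotProduct_sq_le a a'
    rw [ha1, normSqVec_eq_one_of_mem_phaseBeams hNt ha', one_mul] at h
    exact mul_le_of_le_one_right (sq_nonneg _) h

end MmWave

theorem corollary1 (Nt Nr L M : ℕ) (hNt : 0 < Nt) (hNr : 0 < Nr)
    (β : ℕ → ℂ) (σ P : ℝ) (hσ : 0 < σ) (hP : 0 < P)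
    (Dt Dr : ℝ) (ψ : Fin L → ℂ) (θ φ : Fin L → ℝ)
    (H : Matrix (Fin Nr) (Fin Nt) ℂ) (hH : H = channel Nt Nr L Dt Dr ψ θ φ)
    (lmax : Fin L) (hlmax : ∀ l, ‖ψ l‖ ≤ ‖ψ lmax‖)
    (at_max : Fin Nt → ℂ) (hat : at_max = arrayResponse Nt Dt (φ lmax))
    (ar_max : Fin Nr → ℂ) (har : ar_max = arrayResponse Nr Dr (θ lmax))
    (δ : ℝ) (hδ : δ = effectiveGain H ar_max at_max) :
    IsGreatest (feasibleSE 1 1 H M β σ P) (maxSE 1 1 H M β σ P) ∧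
    rateLowerBound Nt M β σ P δ ≤ maxSE 1 1 H M β σ P ∧
    rateLowerBound Nt M β σ P δ ≤ closedFormSE H at_max M β σ P ∧
    closedFormSE H at_max M β σ P ≤ maxSE 1 1 H M β σ P ∧
    (L = 1 → maxSE 1 1 H M β σ P = rateLowerBound Nt M β σ P δ ∧
      closedFormSE H at_max M β σ P = rateLowerBound Nt M β σ P δ) := by
  have hSE := feasibleSE_single H M β hNt hσ hP
  obtain ⟨a, ha, hmax⟩ := exists_isMaxOn_phaseBeams H
  have hamem : at_max ∈ phaseBeams Nt := hat ▸ arrayResponse_mem_phaseBeams Nt Dt _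
  have harmem : ar_max ∈ phaseBeams Nr := har ▸ arrayResponse_mem_phaseBeams Nr Dr _
  have hgreat : IsGreatest (feasibleSE 1 1 H M β σ P)
      (beamRate Nt M β σ P (normSqVec (H *ᵥ a))) := by
    rw [hSE]
    refine ⟨⟨a, ha, rfl⟩, ?_⟩
    rintro _ ⟨a', ha', rfl⟩
    exact beamRate_le_beamRate Nt M β hσ hP (normSqVec_nonneg _) (hmax a' ha')
  have hmaxSE : maxSE 1 1 H M β σ P = beamRate Nt M β σ P (normSqVec (H *ᵥ a)) :=
    hgreat.csSup_eq
  have hδ0 : 0 ≤ δ := hδ ▸ sq_nonneg _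
  rw [hmaxSE, rateLowerBound_eq_beamRate Nt M β hσ hP hδ0, closedFormSE_eq_beamRate H _ M β hσ hP]
  have hle1 : δ ≤ normSqVec (H *ᵥ at_max) := hδ ▸ effectiveGain_le hNr H harmem at_max
  have hle2 := hmax at_max hamem
  have hmono := @beamRate_le_beamRate Nt M β σ P
  refine ⟨hgreat, hmono hσ hP hδ0 (hle1.trans hle2), hmono hσ hP hδ0 hle1,
    hmono hσ hP (normSqVec_nonneg _) hle2, fun hL => ?_⟩
  subst hL
  have hH1 : H = (((Real.sqrt ((Nt : ℝ) * Nr / (1 : ℕ)) : ℝ) : ℂ) * ψ lmax) •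
      vecMulVec ar_max (star at_max) := by
    rw [hH, channel, hat, har, Subsingleton.elim lmax 0, Fin.sum_univ_one, smul_smul]
  obtain ⟨hgain, hpow⟩ := rankOne_mulVec_le hNt hNr _ harmem hamem
  rw [← hH1, ← hδ] at hgain
  -- `hpow` now bounds every beam's received power by `δ`, closing the chain `δ ≤ ‖H a_t‖² ≤ ‖H a‖²
  -- ≤ δ`.
  rw [← hH1, ← hgain] at hpow
  rw [le_antisymm (hpow a ha) (hle1.trans hle2), le_antisymm (hpow at_max hamem) hle1]
  exact ⟨rfl, rfl⟩
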